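/- Let $\mathcal H,\mathcal K$ be finite-dimensional complex Hilbert spaces, let $\rho$ be a density operator on $\mathcal H$ (positive semi-definite, unit trace), let $\sigma\neq 0$ be a positive semi-definite operator on $\mathcal H$, and let $\mathcal N$ be a quantum channel (a linear, completely positive, trace-preserving map) from operators on $\mathcal H$ to operators on $\mathcal K$. Let $U:\mathcal H\to\mathcal K\otimes\mathcal H_E$, with $\mathcal H_E$ finite-dimensional, be any isometric extension of $\mathcal N$, i.e. $U^\dagger U=I$ and $\mathcal N(X)=\operatorname{Tr}_E\{UXU^\dagger\}$ for all $X$. Real powers of a positive semi-definite operator are evaluated on its support (the span of the eigenvectors with non-zero eigenvalues): if $A=\sum_{i:a_i\ne 0}a_i|i\rangle\langle i|$ then $A^s=\sum_{i:a_i\neq0}a_i^s|i\rangle\langle i|$. Write $\|A\|_p=[\operatorname{Tr}|A|^p]^{1/p}$ for $p<\infty$, with $|A|=\sqrt{A^\dagger A}$, and $\|A\|_\infty$ for the operator norm. Define, with values in $[-\infty,+\infty]$ and $\log 0=-\infty$, $$\Delta'_\alpha(\rho,\sigma,\mathcal N)=\frac{2}{\alpha-1}\max_{V_\sigma,V_{\mathcal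 N(\sigma)}}\log\left\|\left([\mathcal N(\rho)]^{\frac{1-\alpha}{2}}V_{\mathcal N(\sigma)}[\mathcal N(\sigma)]^{\frac{\alpha-1}{2}}\otimes I_E\right)U\sigma^{\frac{1-\alpha}{2}}V_\sigma\rho^{\frac{\alpha}{2}}\right\|_2,$$ $$\widetilde\Delta'_\alpha(\rho,\sigma,\mathcal N)=\frac{2}{\alpha'}\max_{V_\sigma,V_{\mathcal N(\sigma)}}\log\left\|\left([\mathcal N(\rho)]^{-\frac{\alpha'}{2}}V_{\mathcal N(\sigma)}[\mathcal N(\sigma)]^{\frac{\alpha'}{2}}\otimes I_E\right)U\sigma^{-\frac{\alpha'}{2}}V_\sigma\rho^{\frac12}\right\|_{2\alpha},$$ where $\alpha'=(\alpha-1)/\alpha$ (and $\alpha'=1$ for $\alpha=\infty$), and the maxima are over all unitaries $V_\sigma$ commuting with $\sigma$ and all unitaries $V_{\mathcal N(\sigma)}$ commuting with $\mathcal N(\sigma)$. Then $\Delta'_\alpha(\rho,\sigma,\mathcal N)\ge 0$ for every $\alpha\in[0,1)$ and $\widetilde\Delta'_\alpha(\rho,\sigma,\mathcal N)\ge 0$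 for every $\alpha\in[1/2,1)$. If moreover $\operatorname{supp}(\rho)\subseteq\operatorname{supp}(\sigma)$, then also $\Delta'_\alpha(\rho,\sigma,\mathcal N)\ge 0$ for every $\alpha\in(1,2]$ and $\widetilde\Delta'_\alpha(\rho,\sigma,\mathcal N)\ge 0$ for every $\alpha\in(1,\infty]$. -/

import Mathlib

open scoped ComplexOrder Kronecker ENNReal

noncomputable section

section Channels

open scoped CStarAlgebra MatrixOrder Matrix.Norms.L2Operator

/-- A quantum channel from operators on `ℂ^n` to operators on `ℂ^m`: a linear, completely positive,
trace-preserving map. -/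
structure QuantumChannel (n m : Type*) [Fintype n] [DecidableEq n] [Fintype m] [DecidableEq m]
    extends Matrix n n ℂ →CP Matrix m m ℂ where
  trace_map : ∀ X : Matrix n n ℂ, (toFun X).trace = X.trace

end Channels

/-- The action of a quantum channel on operators, as a linear map. -/
def QuantumChannel.map {n m : Type*} [Fintype n] [DecidableEq n] [Fintype m] [DecidableEq m]
    (N : QuantumChannel n m) : Matrix n n ℂ →ₗ[ℂ] Matrix m m ℂ where
  toFun X := N.toFun X
  map_add' X Y := N.map_add' X Y
  map_smul' c X := N.map_smul' c X

/-- A density operator: positive semi-definite with unit trace. -/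
def IsDensityOperator {n : Type*} [Fintype n] (ρ : Matrix n n ℂ) : Prop :=
  ρ.PosSemidef ∧ ρ.trace = 1

/-- The partial trace over the second tensor factor. -/
def partialTraceRight {m e : Type*} [Fintype e] (X : Matrix (m × e) (m × e) ℂ) : Matrix m m ℂ :=
  Matrix.of fun i j => ∑ k, X (i, k) (j, k)

/-- `U : ℂ^n → ℂ^m ⊗ ℂ^e` is an isometric extension of the channel `N`:
`U` is an isometry and `N(X) = Tr_E (U X U†)`. -/
def IsIsometricExtension {n m e : Type*} [Fintype n] [DecidableEq n] [Fintype m] [DecidableEq m]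
    [Fintype e] (N : QuantumChannel n m) (U : Matrix (m × e) n ℂ) : Prop :=
  U.conjTranspose * U = 1 ∧
    ∀ X : Matrix n n ℂ, N.map X = partialTraceRight (U * X * U.conjTranspose)

/-- The support of a Hermitian operator: the span of its eigenvectors with non-zero eigenvalue. -/
def opSupport {n : Type*} [Fintype n] (A : Matrix n n ℂ) : Submodule ℂ (n → ℂ) :=
  Submodule.span ℂ {v | ∃ a : ℂ, a ≠ 0 ∧ A.mulVec v = a • v}

/-- The real power `A ^ s` of a positive semi-definite operator, evaluated on its support:
non-zero eigenvalues `a` become `a ^ s`, the kernel is kept (so `A ^ 0` is the support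
projection, and negative powers are generalized inverses). -/
def opPow {n : Type*} [Fintype n] [DecidableEq n] (A : Matrix n n ℂ) (s : ℝ) : Matrix n n ℂ :=
  cfc (fun x : ℝ => if x = 0 then 0 else x ^ s) A

/-- The absolute value `|A| = √(A† A)`. -/
def opAbs {k n : Type*} [Fintype k] [Fintype n] [DecidableEq n] (A : Matrix k n ℂ) :
    Matrix n n ℂ :=
  cfc Real.sqrt (A.conjTranspose * A)

/-- The Schatten `p`-norm `(Tr |A|^p)^(1/p)` for `0 < p < ∞`; for `p = ∞` the operator norm with
respect to the Euclidean norms. -/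
def schattenNorm {k n : Type*} [Fintype k] [Fintype n] [DecidableEq n] (p : ℝ≥0∞)
    (A : Matrix k n ℂ) : ℝ :=
  if p = ∞ then ‖(Matrix.toEuclideanLin A).toContinuousLinearMap‖
  else ((opPow (opAbs A) p.toReal).trace.re) ^ (1 / p.toReal)

/-- The unitaries that commute with `ω`. -/
def swivels {n : Type*} [Fintype n] [DecidableEq n] (ω : Matrix n n ℂ) : Set (Matrix n n ℂ) :=
  {V | V ∈ Matrix.unitaryGroup n ℂ ∧ Commute V ω}

/-- The swiveled Rényi quantity `Δ'_α(ρ, σ, N)`, written with an isometric extension `U` of `N`.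
Values lie in the extended reals, with `log 0 = -∞`; `V` commutes with `σ`, `W` with `N(σ)`.
The supremum is over a non-empty compact set, so it is a maximum. -/
def swiveledDelta {n m e : Type*} [Fintype n] [DecidableEq n] [Fintype m] [DecidableEq m]
    [Fintype e] [DecidableEq e] (α : ℝ) (ρ σ : Matrix n n ℂ) (N : QuantumChannel n m)
    (U : Matrix (m × e) n ℂ) : EReal :=
  ((2 / (α - 1) : ℝ) : EReal) *
    ⨆ V ∈ swivels σ, ⨆ W ∈ swivels (N.map σ),
      ENNReal.log (ENNReal.ofReal (schattenNorm 2
        (((opPow (N.map ρ) ((1 - α) / 2) * W * opPow (N.map σ) ((α - 1) / 2)) ⊗ₖ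
            (1 : Matrix e e ℂ)) *
          U * opPow σ ((1 - α) / 2) * V * opPow ρ (α / 2))))

/-- `α' = (α - 1) / α`, with the limiting value `1` at `α = ∞`. -/
def renyiPrime (α : ℝ≥0∞) : ℝ :=
  if α = ∞ then 1 else (α.toReal - 1) / α.toReal

/-- The swiveled sandwiched Rényi quantity `Δ̃'_α(ρ, σ, N)`, written with an isometric extension
`U` of `N`; the order `α = ∞` is allowed and uses the Schatten `∞`-norm. -/
def swiveledDeltaTilde {n m e : Type*} [Fintype n] [DecidableEq n] [Fintype m] [DecidableEq m]
    [Fintype e] [DecidableEq e] (α : ℝ≥0∞) (ρ σ : Matrix n n ℂ) (N : QuantumChannel n m)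
    (U : Matrix (m × e) n ℂ) : EReal :=
  ((2 / renyiPrime α : ℝ) : EReal) *
    ⨆ V ∈ swivels σ, ⨆ W ∈ swivels (N.map σ),
      ENNReal.log (ENNReal.ofReal (schattenNorm (2 * α)
        (((opPow (N.map ρ) (-renyiPrime α / 2) * W * opPow (N.map σ) (renyiPrime α / 2)) ⊗ₖ
            (1 : Matrix e e ℂ)) *
          U * opPow σ (-renyiPrime α / 2) * V * opPow ρ (1 / 2))))

end

/-! The proof is complex interpolation. Write `R = N(ρ)`, `S = N(σ)` and consider the entire
function F(z) = ((R^(z/2) W S^(-z/2)) ⊗ I) U σ^(z/2) V ρ^((1-z)/2), which at z = 1 - α is the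
operator inside `Δ'_α`. The imaginary part of z only contributes unitary phases: the outer ones do
not affect the Frobenius norm, and those of σ and S commute with σ and S, so they are absorbed into
the swivels V and W (`norm_complexSwiveledOp`). Maximizing over swivels is thus exactly what makes
the bounds uniform on vertical lines. On Re z = 0 the norm is at most ‖ρ^(1/2)‖₂ = 1
(`norm_swiveledOp_zero_le`); on Re z = 1 it is at most ‖R^(1/2)‖₂ = 1 (`norm_swiveledOp_half_le`).

For α < 1 the three lines theorem gives ‖F(1 - α)‖ ≤ 1 for all swivels, and the prefactor 2/(α-1) is
negative. For α > 1 the strip is -τ ≤ Re z ≤ 1 with τ = α - 1. Under the support condition, F(0)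
with V = W = 1 has norm exactly 1, so the supremum on the line Re z = -τ cannot be below 1.

The sandwiched quantity reduces to the same estimates with τ or -θ equal to α': multiplying its
operator by ρ^(α'/2) yields a value of F, and Hölder's inequality with a power of ρ of norm 1
compares the Schatten 2α-norm with the Frobenius norm. Hölder follows from weighted AM-GM on pairs
of eigenvalues. -/

namespace SwiveledRenyi

open Matrix

/-! ### Spectral calculus of Hermitian matrices, powers on the support, and phases -/

section Spectral

variable {n : Type*} [Fintype n] [DecidableEq n] {A B : Matrix n n ℂ}

/-- The complex-valued functional calculus of a Hermitian matrix. -/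
noncomputable def spectralMap (hA : A.IsHermitian) (g : ℝ → ℂ) : Matrix n n ℂ :=
  (hA.eigenvectorUnitary : Matrix n n ℂ) * diagonal (fun i => g (hA.eigenvalues i)) *
    (hA.eigenvectorUnitary : Matrix n n ℂ)ᴴ

lemma conjTranspose_mul_eigenvectorUnitary (hA : A.IsHermitian) :
    (hA.eigenvectorUnitary : Matrix n n ℂ)ᴴ * (hA.eigenvectorUnitary : Matrix n n ℂ) = 1 :=
  Unitary.coe_star_mul_self hA.eigenvectorUnitary

lemma eigenvectorUnitary_mul_conjTranspose (hA : A.IsHermitian) :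
    (hA.eigenvectorUnitary : Matrix n n ℂ) * (hA.eigenvectorUnitary : Matrix n n ℂ)ᴴ = 1 :=
  Unitary.coe_mul_star_self hA.eigenvectorUnitary

lemma cfc_eq_spectralMap (hA : A.IsHermitian) (f : ℝ → ℝ) :
    cfc f A = spectralMap hA (fun x => (f x : ℂ)) := by
  rw [hA.cfc_eq f, IsHermitian.cfc, Unitary.conjStarAlgAut_apply]
  rfl

lemma spectralMap_ofReal (hA : A.IsHermitian) : spectralMap hA (fun x => (x : ℂ)) = A := by
  rw [← cfc_eq_spectralMap hA (fun x => x)]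
  exact cfc_id' ℝ A hA

lemma spectralMap_one (hA : A.IsHermitian) : spectralMap hA (fun _ => 1) = 1 := by
  simp [spectralMap, eigenvectorUnitary_mul_conjTranspose]

lemma spectralMap_congr (hA : A.IsHermitian) {f g : ℝ → ℂ}
    (h : ∀ i, f (hA.eigenvalues i) = g (hA.eigenvalues i)) :
    spectralMap hA f = spectralMap hA g := by
  simp [spectralMap, h]

lemma spectralMap_mul (hA : A.IsHermitian) (f g : ℝ → ℂ) :
    spectralMap hA f * spectralMap hA g = spectralMap hA (fun x => f x * g x) := by
  simp only [spectralMap]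
  rw [← diagonal_mul_diagonal]
  simp only [Matrix.mul_assoc]
  rw [← Matrix.mul_assoc _ᴴ (hA.eigenvectorUnitary : Matrix n n ℂ),
    conjTranspose_mul_eigenvectorUnitary, Matrix.one_mul]

lemma conjTranspose_spectralMap (hA : A.IsHermitian) (f : ℝ → ℂ) :
    (spectralMap hA f)ᴴ = spectralMap hA (fun x => star (f x)) := by
  simp only [spectralMap, conjTranspose_mul, conjTranspose_conjTranspose, diagonal_conjTranspose,
    Matrix.mul_assoc]
  rfl

lemma spectralMap_commute (hA : A.IsHermitian) (f : ℝ → ℂ) : Commute (spectralMap hA f) A := by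
  have h : Commute (spectralMap hA f) (spectralMap hA (fun x => (x : ℂ))) := by
    rw [Commute, SemiconjBy, spectralMap_mul, spectralMap_mul]
    simp only [mul_comm]
  rwa [spectralMap_ofReal] at h

/-- The weights |⟨eᵢ, fⱼ⟩|² between the two eigenbases are nonnegative, which reduces trace
inequalities to scalar ones. -/
lemma trace_spectralMap_mul (hA : A.IsHermitian) (hB : B.IsHermitian) (f g : ℝ → ℝ) :
    (spectralMap hA (fun x => (f x : ℂ)) * spectralMap hB (fun x => (g x : ℂ))).trace.re =
      ∑ i, ∑ j, f (hA.eigenvalues i) * g (hB.eigenvalues j) *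
        Complex.normSq (((hA.eigenvectorUnitary : Matrix n n ℂ)ᴴ *
          (hB.eigenvectorUnitary : Matrix n n ℂ)) i j) := by
  set P := (hA.eigenvectorUnitary : Matrix n n ℂ)
  set Q := (hB.eigenvectorUnitary : Matrix n n ℂ)
  have h : (spectralMap hA (fun x => (f x : ℂ)) * spectralMap hB (fun x => (g x : ℂ))).trace =
      (diagonal (fun i => (f (hA.eigenvalues i) : ℂ)) * (Pᴴ * Q) *
        diagonal (fun i => (g (hB.eigenvalues i) : ℂ)) * (Pᴴ * Q)ᴴ).trace := by
    simp only [spectralMap, conjTranspose_mul, conjTranspose_conjTranspose, Matrix.mul_assoc]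
    rw [trace_mul_comm]
    simp only [Matrix.mul_assoc]
    rfl
  rw [h]
  simp only [trace, diag_apply, Matrix.mul_apply (N := (Pᴴ * Q)ᴴ), mul_diagonal, diagonal_mul,
    Complex.re_sum]
  refine Finset.sum_congr rfl fun i _ => Finset.sum_congr rfl fun j _ => ?_
  rw [conjTranspose_apply, Complex.star_def]
  have := Complex.mul_conj ((Pᴴ * Q) i j)
  rw [show ((f (hA.eigenvalues i) : ℂ) * (Pᴴ * Q) i j * (g (hB.eigenvalues j) : ℂ) *
    (starRingEnd ℂ) ((Pᴴ * Q) i j)) = ((f (hA.eigenvalues i) * g (hB.eigenvalues j) *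
      Complex.normSq ((Pᴴ * Q) i j) : ℝ) : ℂ) by push_cast; rw [← this]; ring]
  exact Complex.ofReal_re _

/-- A Klein-type inequality: scalar inequalities between products pass to traces. -/
lemma trace_spectralMap_mul_le (hA : A.IsHermitian) (hB : B.IsHermitian)
    {f₁ g₁ f₂ g₂ f₃ g₃ : ℝ → ℝ}
    (h : ∀ i j, f₃ (hA.eigenvalues i) * g₃ (hB.eigenvalues j) ≤
      f₁ (hA.eigenvalues i) * g₁ (hB.eigenvalues j) +
        f₂ (hA.eigenvalues i) * g₂ (hB.eigenvalues j)) :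
    (spectralMap hA (fun x => (f₃ x : ℂ)) * spectralMap hB (fun x => (g₃ x : ℂ))).trace.re ≤
      (spectralMap hA (fun x => (f₁ x : ℂ)) * spectralMap hB (fun x => (g₁ x : ℂ))).trace.re +
      (spectralMap hA (fun x => (f₂ x : ℂ)) * spectralMap hB (fun x => (g₂ x : ℂ))).trace.re := by
  simp only [trace_spectralMap_mul, ← Finset.sum_add_distrib, ← add_mul]
  gcongr with i _ j _
  · exact Complex.normSq_nonneg _
  · exact h i j

/-- Complex powers on the support, with value `0` at `0`. -/
noncomputable def cpowSupp (z : ℂ) (x : ℝ) : ℂ := if x = 0 then 0 else (x : ℂ) ^ z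

/-- Real powers on the support, with value `0` at `0`. -/
noncomputable def rpowSupp (s : ℝ) (x : ℝ) : ℝ := if x = 0 then 0 else x ^ s

lemma opPow_eq (hA : A.IsHermitian) (s : ℝ) :
    opPow A s = spectralMap hA (fun x => (rpowSupp s x : ℂ)) :=
  cfc_eq_spectralMap hA _

lemma opPow_eq_cpowSupp (hA : A.PosSemidef) (s : ℝ) :
    opPow A s = spectralMap hA.isHermitian (cpowSupp s) := by
  rw [opPow_eq hA.isHermitian]
  refine spectralMap_congr _ fun i => ?_
  have := hA.eigenvalues_nonneg i
  unfold rpowSupp cpowSupp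
  split_ifs
  · simp
  · rw [Complex.ofReal_cpow this]

lemma opPow_mul (hA : A.PosSemidef) (s t : ℝ) : opPow A s * opPow A t = opPow A (s + t) := by
  rw [opPow_eq hA.isHermitian, opPow_eq hA.isHermitian, opPow_eq hA.isHermitian, spectralMap_mul]
  refine spectralMap_congr _ fun i => ?_
  have := hA.eigenvalues_nonneg i
  unfold rpowSupp
  split_ifs with h
  · simp
  · rw [Real.rpow_add (lt_of_le_of_ne this (Ne.symm h))]
    push_cast
    rfl

lemma opPow_one (hA : A.PosSemidef) : opPow A 1 = A := by
  conv_rhs => rw [← spectralMap_ofReal hA.isHermitian]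
  rw [opPow_eq hA.isHermitian]
  refine spectralMap_congr _ fun i => ?_
  unfold rpowSupp
  split_ifs with h <;> simp [h]

lemma conjTranspose_opPow (hA : A.IsHermitian) (s : ℝ) : (opPow A s)ᴴ = opPow A s := by
  rw [opPow_eq hA, conjTranspose_spectralMap]
  simp

lemma opPow_zero_mul (hA : A.PosSemidef) : opPow A 0 * A = A := by
  have := opPow_mul hA 0 1
  rwa [zero_add, opPow_one hA] at this

/-- A unimodular function, equal to `x ^ (it)` off `0`. -/
noncomputable def phase (t : ℝ) (x : ℝ) : ℂ := if x = 0 then 1 else (x : ℂ) ^ (t * Complex.I)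

lemma phase_mul_star {x : ℝ} (hx : 0 ≤ x) (t : ℝ) : phase t x * star (phase t x) = 1 := by
  unfold phase
  split_ifs with h
  · simp
  · rw [Complex.star_def, Complex.mul_conj, Complex.normSq_eq_norm_sq,
      Complex.norm_cpow_eq_rpow_re_of_pos (lt_of_le_of_ne hx (Ne.symm h))]
    simp

/-- The value 1 of `phase` at 0, in place of the 0 of `cpowSupp`, is what makes this matrix unitary
on the kernel too. -/
lemma spectralMap_phase_mem_swivels (hA : A.PosSemidef) (t : ℝ) :
    spectralMap hA.isHermitian (phase t) ∈ swivels A := by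
  refine ⟨?_, spectralMap_commute _ _⟩
  rw [mem_unitaryGroup_iff, star_eq_conjTranspose, conjTranspose_spectralMap, spectralMap_mul,
    ← spectralMap_one hA.isHermitian]
  exact spectralMap_congr _ fun i => phase_mul_star (hA.eigenvalues_nonneg i) t

lemma spectralMap_cpowSupp_eq (hA : A.PosSemidef) (s t : ℝ) :
    spectralMap hA.isHermitian (cpowSupp (s + t * Complex.I)) =
      spectralMap hA.isHermitian (phase t) * opPow A s := by
  rw [opPow_eq_cpowSupp hA, spectralMap_mul]
  refine spectralMap_congr _ fun i => ?_
  unfold phase cpowSupp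
  split_ifs with h
  · simp
  · rw [Complex.cpow_add _ _ (by exact_mod_cast h), mul_comm]

lemma spectralMap_phase_comm (hA : A.PosSemidef) (s t : ℝ) :
    spectralMap hA.isHermitian (phase t) * opPow A s =
      opPow A s * spectralMap hA.isHermitian (phase t) := by
  rw [opPow_eq_cpowSupp hA, spectralMap_mul, spectralMap_mul]
  simp only [mul_comm]

lemma posSemidef_opPow (hA : A.PosSemidef) (s : ℝ) : (opPow A s).PosSemidef := by
  have h := posSemidef_conjTranspose_mul_self (opPow A (s / 2))
  rwa [conjTranspose_opPow hA.isHermitian, opPow_mul hA, add_halves] at h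

/-- The support projection of B fixes the span `opSupport B`. On an eigenbasis of A, the image under
A is either 0 or a multiple of a vector in `opSupport A`. -/
lemma opPow_zero_mul_of_opSupport_le (hA : A.IsHermitian) (hB : B.PosSemidef)
    (h : opSupport A ≤ opSupport B) : opPow B 0 * A = A := by
  have hfix : ∀ v ∈ opSupport B, opPow B 0 *ᵥ v = v := by
    intro v hv
    refine Submodule.span_induction (p := fun v _ => opPow B 0 *ᵥ v = v) ?_ ?_ ?_ ?_ hv
    · rintro v ⟨a, ha, hav⟩
      have : a • (opPow B 0 *ᵥ v) = a • v := by
        rw [← mulVec_smul, ← hav, mulVec_mulVec, opPow_zero_mul hB]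
      exact smul_right_injective _ ha this
    · simp
    · intro x y _ _ hx hy
      rw [mulVec_add, hx, hy]
    · intro a x _ hx
      rw [mulVec_smul, hx]
  have hcol : opPow B 0 * A * (hA.eigenvectorUnitary : Matrix n n ℂ) =
      A * (hA.eigenvectorUnitary : Matrix n n ℂ) := by
    refine Matrix.ext_col fun j => ?_
    have e := hA.mulVec_eigenvectorBasis j
    have hv : (hA.eigenvectorUnitary : Matrix n n ℂ).col j = ⇑(hA.eigenvectorBasis j) :=
      hA.eigenvectorUnitary_col_eq j
    rw [← mulVec_single_one, ← mulVec_single_one, ← mulVec_mulVec, ← mulVec_mulVec,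
      mulVec_single_one, hv, ← mulVec_mulVec, mulVec_single_one, hv, e]
    by_cases h0 : hA.eigenvalues j = 0
    · simp [h0]
    · rw [mulVec_smul, hfix]
      refine h (Submodule.subset_span ⟨(hA.eigenvalues j : ℂ), by exact_mod_cast h0, ?_⟩)
      rw [e]
      ext; simp
  calc opPow B 0 * A = opPow B 0 * A * (hA.eigenvectorUnitary : Matrix n n ℂ) *
        (hA.eigenvectorUnitary : Matrix n n ℂ)ᴴ := by
        rw [Matrix.mul_assoc _ _ _ᴴ, eigenvectorUnitary_mul_conjTranspose, Matrix.mul_one]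
    _ = A := by
        rw [hcol, Matrix.mul_assoc, eigenvectorUnitary_mul_conjTranspose, Matrix.mul_one]

end Spectral

/-! ### Invariance and contraction properties of the Frobenius norm -/

section Frobenius

open scoped Matrix.Norms.Frobenius

variable {k l n : Type*} [Fintype k] [Fintype l] [Fintype n]

lemma frobenius_norm_sq (A : Matrix k n ℂ) : ‖A‖ ^ 2 = (Aᴴ * A).trace.re := by
  rw [frobenius_norm_def, ← Real.sqrt_eq_rpow, Real.sq_sqrt (by positivity), Finset.sum_comm]
  simp only [trace, diag_apply, mul_apply, Complex.re_sum, conjTranspose_apply]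
  refine Finset.sum_congr rfl fun i _ => Finset.sum_congr rfl fun j _ => ?_
  rw [Complex.star_def, mul_comm, Complex.mul_conj, Complex.ofReal_re, Complex.normSq_eq_norm_sq]
  simp

lemma frobenius_norm_mul_of_isometry [DecidableEq k] {C : Matrix l k ℂ} (hC : Cᴴ * C = 1)
    (A : Matrix k n ℂ) : ‖C * A‖ = ‖A‖ := by
  rw [← sq_eq_sq₀ (norm_nonneg _) (norm_nonneg _), frobenius_norm_sq, frobenius_norm_sq,
    conjTranspose_mul, Matrix.mul_assoc, ← Matrix.mul_assoc Cᴴ, hC, Matrix.one_mul]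

lemma frobenius_norm_mul_unitary [DecidableEq n] {C : Matrix n n ℂ}
    (hC : C ∈ unitaryGroup n ℂ) (A : Matrix k n ℂ) : ‖A * C‖ = ‖A‖ := by
  rw [← frobenius_norm_conjTranspose, conjTranspose_mul,
    frobenius_norm_mul_of_isometry, frobenius_norm_conjTranspose]
  rw [conjTranspose_conjTranspose]
  exact mem_unitaryGroup_iff.1 hC

/-- Pythagoras for the orthogonal decomposition A = PA + (1 - P)A. -/
lemma frobenius_norm_mul_of_projection [DecidableEq k] {P : Matrix k k ℂ} (hP : Pᴴ = P)
    (hPP : P * P = P) (A : Matrix k n ℂ) : ‖P * A‖ ≤ ‖A‖ := by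
  have h : ‖P * A‖ ^ 2 + ‖(1 - P) * A‖ ^ 2 = ‖A‖ ^ 2 := by
    simp only [frobenius_norm_sq, conjTranspose_mul, conjTranspose_sub, conjTranspose_one, hP]
    rw [← Complex.add_re, ← trace_add]
    congr 2
    simp only [Matrix.mul_assoc]
    rw [← Matrix.mul_assoc P P, hPP, ← Matrix.mul_assoc (1 - P) (1 - P),
      show (1 - P) * (1 - P) = 1 - P by simp [sub_mul, mul_sub, hPP], ← Matrix.mul_add,
      Matrix.sub_mul, Matrix.one_mul]
    simp
  nlinarith [norm_nonneg (P * A), norm_nonneg A, sq_nonneg ‖(1 - P) * A‖]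

lemma frobenius_norm_mul_projection [DecidableEq n] {P : Matrix n n ℂ} (hP : Pᴴ = P)
    (hPP : P * P = P) (A : Matrix k n ℂ) : ‖A * P‖ ≤ ‖A‖ := by
  rw [← frobenius_norm_conjTranspose, conjTranspose_mul, ← frobenius_norm_conjTranspose A, hP]
  exact frobenius_norm_mul_of_projection hP hPP _

end Frobenius

/-! ### Schatten norms through powers of X†X -/

section Schatten

open scoped Matrix.Norms.Frobenius

variable {k n : Type*} [Fintype k] [Fintype n] [DecidableEq n]

lemma opPow_opAbs (X : Matrix k n ℂ) (a : ℝ) : opPow (opAbs X) (2 * a) = opPow (Xᴴ * X) a := by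
  have hM := posSemidef_conjTranspose_mul_self X
  have : IsSelfAdjoint (Xᴴ * X) := hM.isHermitian
  unfold opPow opAbs
  -- The power may be discontinuous at 0, but continuity is required only on the image of a finite
  -- spectrum, which is discrete.
  rw [← cfc_comp' (fun x : ℝ => if x = 0 then 0 else x ^ (2 * a)) Real.sqrt (Xᴴ * X)
    (by rw [continuousOn_iff_continuous_domRestrict]; fun_prop) (by fun_prop)]
  rw [cfc_eq_spectralMap hM.isHermitian, cfc_eq_spectralMap hM.isHermitian]
  refine spectralMap_congr _ fun i => ?_
  have hx := hM.eigenvalues_nonneg i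
  simp only [Real.sqrt_eq_zero hx]
  split_ifs
  · rfl
  · rw [Real.sqrt_eq_rpow, ← Real.rpow_mul hx]
    congr 2
    ring

lemma schattenNorm_two_mul (X : Matrix k n ℂ) {a : ℝ≥0∞} (ha : a ≠ ∞) :
    schattenNorm (2 * a) X = ((opPow (Xᴴ * X) a.toReal).trace.re) ^ (1 / (2 * a.toReal)) := by
  unfold schattenNorm
  rw [if_neg (ENNReal.mul_ne_top (by simp) ha)]
  simp [ENNReal.toReal_mul, opPow_opAbs]

lemma schattenNorm_two (X : Matrix k n ℂ) : schattenNorm 2 X = ‖X‖ := by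
  have := schattenNorm_two_mul X (a := 1) (by simp)
  rw [mul_one] at this
  rw [this, ENNReal.toReal_one, opPow_one (posSemidef_conjTranspose_mul_self X),
    ← frobenius_norm_sq, mul_one, ← Real.sqrt_eq_rpow, Real.sqrt_sq (norm_nonneg _)]

end Schatten

/-! ### Functions bounded on vertical strips and the three lines theorem -/

section Strip

open scoped Matrix.Norms.Frobenius

/-- Entire functions that are bounded on every closed vertical strip. -/
def StripBounded (f : ℂ → ℂ) : Prop :=
  Differentiable ℂ f ∧ ∀ a b : ℝ, ∃ C, ∀ z : ℂ, a ≤ z.re → z.re ≤ b → ‖f z‖ ≤ C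

lemma StripBounded.const (c : ℂ) : StripBounded fun _ => c :=
  ⟨differentiable_const c, fun _ _ => ⟨‖c‖, fun _ _ _ => le_rfl⟩⟩

lemma StripBounded.mul {f g : ℂ → ℂ} (hf : StripBounded f) (hg : StripBounded g) :
    StripBounded fun z => f z * g z := by
  refine ⟨hf.1.mul hg.1, fun a b => ?_⟩
  obtain ⟨C, hC⟩ := hf.2 a b
  obtain ⟨D, hD⟩ := hg.2 a b
  refine ⟨C * D, fun z ha hb => ?_⟩
  rw [norm_mul]
  exact mul_le_mul (hC z ha hb) (hD z ha hb) (norm_nonneg _)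
    ((norm_nonneg _).trans (hC z ha hb))

lemma StripBounded.sum {ι : Type*} {s : Finset ι} {f : ι → ℂ → ℂ}
    (hf : ∀ i, StripBounded (f i)) : StripBounded fun z => ∑ i ∈ s, f i z := by
  refine ⟨Differentiable.fun_sum fun i _ => (hf i).1, fun a b => ?_⟩
  choose C hC using fun i => (hf i).2 a b
  exact ⟨∑ i ∈ s, C i, fun z ha hb =>
    (norm_sum_le _ _).trans (Finset.sum_le_sum fun i _ => hC i z ha hb)⟩

/-- For x > 0 the modulus x^(c Re z + d) depends only on Re z, hence is bounded on compact ranges of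
Re z. For x = 0 the function is constantly 0, so negative powers create no singularity. -/
lemma stripBounded_cpowSupp {x : ℝ} (hx : 0 ≤ x) (c d : ℝ) :
    StripBounded fun z => cpowSupp (c * z + d) x := by
  unfold cpowSupp
  split_ifs with h
  · exact StripBounded.const 0
  have hx' : 0 < x := lt_of_le_of_ne hx (Ne.symm h)
  have hx0 : (x : ℂ) ≠ 0 := by exact_mod_cast h
  refine ⟨fun z => ?_, fun a b => ?_⟩
  · exact ((((differentiableAt_id).const_mul (c : ℂ)).add_const (d : ℂ))).const_cpow (Or.inl hx0)
  · have hc : ContinuousOn (fun r : ℝ => x ^ (c * r + d)) (Set.Icc a b) :=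
      (Continuous.rpow continuous_const (by fun_prop) fun _ => Or.inl hx'.ne').continuousOn
    obtain ⟨C, hC⟩ := isCompact_Icc.exists_bound_of_continuousOn hc
    refine ⟨C, fun z ha hb => ?_⟩
    rw [Complex.norm_cpow_eq_rpow_re_of_pos hx']
    have := hC z.re ⟨ha, hb⟩
    rw [Real.norm_of_nonneg (Real.rpow_nonneg hx _)] at this
    simpa using this

/-- Matrix-valued functions all of whose entries are entire and bounded on strips. -/
def MatrixStripBounded {k n : Type*} (F : ℂ → Matrix k n ℂ) : Prop :=
  ∀ i j, StripBounded fun z => F z i j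

variable {k l n : Type*}

lemma MatrixStripBounded.const (A : Matrix k n ℂ) : MatrixStripBounded fun _ => A :=
  fun _ _ => StripBounded.const _

lemma MatrixStripBounded.mul [Fintype l] {F : ℂ → Matrix k l ℂ} {G : ℂ → Matrix l n ℂ}
    (hF : MatrixStripBounded F) (hG : MatrixStripBounded G) :
    MatrixStripBounded fun z => F z * G z := by
  intro i j
  simp only [mul_apply]
  exact StripBounded.sum fun x => (hF i x).mul (hG x j)

lemma MatrixStripBounded.kronecker_const {k' n' : Type*} {F : ℂ → Matrix k n ℂ}
    (hF : MatrixStripBounded F) (B : Matrix k' n' ℂ) : MatrixStripBounded fun z => F z ⊗ₖ B := by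
  rintro ⟨i, i'⟩ ⟨j, j'⟩
  exact (hF i j).mul (StripBounded.const (B i' j'))

lemma matrixStripBounded_spectralMap [Fintype n] [DecidableEq n] {A : Matrix n n ℂ}
    (hA : A.PosSemidef) (c d : ℝ) :
    MatrixStripBounded fun z => spectralMap hA.isHermitian (cpowSupp (c * z + d)) := by
  unfold spectralMap
  refine ((MatrixStripBounded.const _).mul ?_).mul (MatrixStripBounded.const _)
  intro i j
  by_cases h : i = j
  · subst h
    simpa only [diagonal_apply_eq] using
      stripBounded_cpowSupp (hA.eigenvalues_nonneg i) c d
  · simpa only [diagonal_apply_ne _ h] using StripBounded.const 0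

variable [Fintype k] [Fintype n]

/-- The three lines theorem for the Frobenius norm. -/
lemma MatrixStripBounded.three_lines [DecidableEq k] [DecidableEq n] {F : ℂ → Matrix k n ℂ}
    (hF : MatrixStripBounded F) {l u a b : ℝ} (hlu : l < u)
    (ha : ∀ z : ℂ, z.re = l → ‖F z‖ ≤ a) (hb : ∀ z : ℂ, z.re = u → ‖F z‖ ≤ b)
    {z : ℂ} (hl : l ≤ z.re) (hu : z.re ≤ u) :
    ‖F z‖ ≤ a ^ (1 - (z.re - l) / (u - l)) * b ^ ((z.re - l) / (u - l)) := by
  have hsum : ∀ z, F z = ∑ i, ∑ j, F z i j • single i j (1 : ℂ) := by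
    intro z
    conv_lhs => rw [matrix_eq_sum_single (F z)]
    simp [smul_single]
  refine Complex.HadamardThreeLines.norm_le_interp_of_mem_verticalClosedStrip' hlu ⟨hl, hu⟩
    ?_ ?_ ha hb
  · have : F = fun z => ∑ i, ∑ j, F z i j • single i j (1 : ℂ) := funext hsum
    rw [this]
    exact (Differentiable.fun_sum fun i _ => Differentiable.fun_sum fun j _ =>
      (hF i j).1.smul_const _).diffContOnCl
  · choose C hC using fun i j => (hF i j).2 l u
    refine ⟨∑ i, ∑ j, C i j * ‖single i j (1 : ℂ)‖, ?_⟩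
    rintro _ ⟨z, ⟨hz1, hz2⟩, rfl⟩
    rw [Function.comp_apply, hsum z]
    refine (norm_sum_le _ _).trans (Finset.sum_le_sum fun i _ => (norm_sum_le _ _).trans
      (Finset.sum_le_sum fun j _ => ?_))
    rw [norm_smul]
    exact mul_le_mul_of_nonneg_right (hC i j z hz1 hz2) (norm_nonneg _)

end Strip

/-! ### Partial trace and the Frobenius norm -/

section PartialTrace

open scoped Matrix.Norms.Frobenius

variable {n m e : Type*} [Fintype n] [Fintype m] [Fintype e] [DecidableEq e]

lemma partialTraceRight_posSemidef {m e : Type*} [Fintype e] {X : Matrix (m × e) (m × e) ℂ}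
    (hX : X.PosSemidef) :
    (partialTraceRight X).PosSemidef := by
  have h : partialTraceRight X =
      ∑ k, X.submatrix (fun i => (i, k)) (fun i => (i, k)) := by
    ext i j
    simp [partialTraceRight, Matrix.sum_apply]
  rw [h]
  exact posSemidef_sum _ fun k _ => hX.submatrix _

lemma trace_kronecker_one_mul (C : Matrix m m ℂ) (X : Matrix (m × e) (m × e) ℂ) :
    ((C ⊗ₖ (1 : Matrix e e ℂ)) * X).trace = (C * partialTraceRight X).trace := by
  simp only [trace, diag_apply, mul_apply, Fintype.sum_prod_type, partialTraceRight, of_apply,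
    kronecker_apply, Finset.mul_sum]
  refine Finset.sum_congr rfl fun i _ => ?_
  rw [Finset.sum_comm]
  refine Finset.sum_congr rfl fun j _ => Finset.sum_congr rfl fun x _ => ?_
  simp [one_apply]

/-- The squared norm is Tr[(B†B ⊗ I) U A A† U†], which sees the environment only through the partial
trace. This replaces Uσ^(1/2) by N(σ)^(1/2). -/
lemma frobenius_norm_kronecker_mul [DecidableEq m] (B : Matrix m m ℂ) (U : Matrix (m × e) n ℂ)
    (A : Matrix n n ℂ) {C : Matrix m m ℂ} (hC : partialTraceRight (U * (A * Aᴴ) * Uᴴ) = C * Cᴴ) :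
    ‖(B ⊗ₖ (1 : Matrix e e ℂ)) * U * A‖ = ‖B * C‖ := by
  have hL : (((B ⊗ₖ (1 : Matrix e e ℂ)) * U * A)ᴴ * ((B ⊗ₖ (1 : Matrix e e ℂ)) * U * A)).trace =
      (((Bᴴ * B) ⊗ₖ (1 : Matrix e e ℂ)) * (U * (A * Aᴴ) * Uᴴ)).trace := by
    have h1 : (Bᴴ * B) ⊗ₖ (1 : Matrix e e ℂ) =
        (B ⊗ₖ (1 : Matrix e e ℂ))ᴴ * (B ⊗ₖ (1 : Matrix e e ℂ)) := by
      rw [conjTranspose_kronecker, conjTranspose_one, ← mul_kronecker_mul, Matrix.mul_one]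
    rw [h1, trace_mul_comm, Matrix.mul_assoc _ᴴ, trace_mul_comm _ᴴ]
    simp only [conjTranspose_mul, Matrix.mul_assoc]
  rw [← sq_eq_sq₀ (norm_nonneg _) (norm_nonneg _), frobenius_norm_sq, frobenius_norm_sq, hL,
    trace_kronecker_one_mul, hC, conjTranspose_mul, trace_mul_comm, Matrix.mul_assoc,
    trace_mul_comm]
  simp only [Matrix.mul_assoc]

end PartialTrace

/-! ### The interpolating family and its bounds on vertical lines -/

section SwiveledOperator

open scoped Matrix.Norms.Frobenius

lemma partialTraceRight_sqrt {n m e : Type*} [Fintype n] [DecidableEq n] [Fintype m]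
    [DecidableEq m] [Fintype e] {σ : Matrix n n ℂ} {S : Matrix m m ℂ} {U : Matrix (m × e) n ℂ}
    (hσ : σ.PosSemidef) (hS : S.PosSemidef)
    (hSU : partialTraceRight (U * σ * Uᴴ) = S) :
    partialTraceRight (U * (opPow σ (1 / 2) * (opPow σ (1 / 2))ᴴ) * Uᴴ) =
      opPow S (1 / 2) * (opPow S (1 / 2))ᴴ := by
  rw [conjTranspose_opPow hσ.isHermitian, conjTranspose_opPow hS.isHermitian,
    opPow_mul hσ, opPow_mul hS, add_halves, opPow_one hσ, opPow_one hS, hSU]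

variable {n m e : Type*} [Fintype n] [DecidableEq n] [Fintype m] [DecidableEq m]
    [Fintype e] [DecidableEq e]

/-- The operator `((R ^ s W S ^ (-s)) ⊗ I) U σ ^ s V ρ ^ c`. -/
noncomputable def swiveledOp (R S : Matrix m m ℂ) (U : Matrix (m × e) n ℂ) (σ ρ : Matrix n n ℂ)
    (s c : ℝ) (V : Matrix n n ℂ) (W : Matrix m m ℂ) : Matrix (m × e) n ℂ :=
  ((opPow R s * W * opPow S (-s)) ⊗ₖ (1 : Matrix e e ℂ)) * U * opPow σ s * V * opPow ρ c

/-- The operator `((R ^ (z/2) W S ^ (-z/2)) ⊗ I) U σ ^ (z/2) V ρ ^ ((1-z)/2)` with complex `z`. -/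
noncomputable def complexSwiveledOp {R S : Matrix m m ℂ} (hR : R.PosSemidef) (hS : S.PosSemidef)
    (U : Matrix (m × e) n ℂ) {σ ρ : Matrix n n ℂ} (hσ : σ.PosSemidef) (hρ : ρ.PosSemidef)
    (V : Matrix n n ℂ) (W : Matrix m m ℂ) (z : ℂ) : Matrix (m × e) n ℂ :=
  ((spectralMap hR.isHermitian (cpowSupp (((1 / 2 : ℝ) : ℂ) * z + (0 : ℝ))) * W *
      spectralMap hS.isHermitian (cpowSupp (((-1 / 2 : ℝ) : ℂ) * z + (0 : ℝ)))) ⊗ₖ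
      (1 : Matrix e e ℂ)) * U *
    spectralMap hσ.isHermitian (cpowSupp (((1 / 2 : ℝ) : ℂ) * z + (0 : ℝ))) * V *
    spectralMap hρ.isHermitian (cpowSupp (((-1 / 2 : ℝ) : ℂ) * z + (1 / 2 : ℝ)))

variable {R S : Matrix m m ℂ} {U : Matrix (m × e) n ℂ} {σ ρ : Matrix n n ℂ}
  {V : Matrix n n ℂ} {W : Matrix m m ℂ}

lemma matrixStripBounded_complexSwiveledOp (hR : R.PosSemidef) (hS : S.PosSemidef)
    (hσ : σ.PosSemidef) (hρ : ρ.PosSemidef) :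
    MatrixStripBounded (complexSwiveledOp hR hS U hσ hρ V W) :=
  ((((((matrixStripBounded_spectralMap hR _ _).mul (.const W)).mul
    (matrixStripBounded_spectralMap hS _ _)).kronecker_const _).mul (.const U)).mul
    (matrixStripBounded_spectralMap hσ _ _)).mul (.const V) |>.mul
    (matrixStripBounded_spectralMap hρ _ _)

lemma spectralMap_cpowSupp_affine {A : Matrix n n ℂ} (hA : A.PosSemidef) (c d : ℝ) (z : ℂ) :
    spectralMap hA.isHermitian (cpowSupp (c * z + d)) =
      spectralMap hA.isHermitian (phase (c * z.im)) * opPow A (c * z.re + d) := by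
  rw [← spectralMap_cpowSupp_eq hA]
  congr 2
  apply Complex.ext <;> simp

lemma complexSwiveledOp_ofReal (hR : R.PosSemidef) (hS : S.PosSemidef) (hσ : σ.PosSemidef)
    (hρ : ρ.PosSemidef) (r : ℝ) : complexSwiveledOp hR hS U hσ hρ V W r =
      swiveledOp R S U σ ρ (r / 2) ((1 - r) / 2) V W := by
  have h : ∀ c d : ℝ, (c : ℂ) * (r : ℂ) + (d : ℂ) = ((c * r + d : ℝ) : ℂ) := fun c d => by simp
  unfold complexSwiveledOp swiveledOp
  rw [opPow_eq_cpowSupp hR, opPow_eq_cpowSupp hS, opPow_eq_cpowSupp hσ, opPow_eq_cpowSupp hρ]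
  simp only [h]
  ring_nf

lemma mul_mem_swivels {A V V' : Matrix n n ℂ} (hV : V ∈ swivels A) (hV' : V' ∈ swivels A) :
    V * V' ∈ swivels A :=
  ⟨mul_mem hV.1 hV'.1, hV.2.mul_left hV'.2⟩

lemma one_mem_swivels (A : Matrix n n ℂ) : 1 ∈ swivels A := ⟨one_mem _, Commute.one_left A⟩

lemma kronecker_one_isometry {C : Matrix m m ℂ} (hC : C ∈ unitaryGroup m ℂ) :
    (C ⊗ₖ (1 : Matrix e e ℂ))ᴴ * (C ⊗ₖ (1 : Matrix e e ℂ)) = 1 := by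
  rw [conjTranspose_kronecker, ← mul_kronecker_mul, conjTranspose_one, Matrix.one_mul,
    ← star_eq_conjTranspose, mem_unitaryGroup_iff'.1 hC, one_kronecker_one]

/-- Each complex power is a unitary phase times a real power. The phases of R and ρ stand at the two
ends and drop out of the norm; those of σ and S stand next to V and W and turn them into other
swivels. -/
lemma norm_complexSwiveledOp (hR : R.PosSemidef) (hS : S.PosSemidef) (hσ : σ.PosSemidef)
    (hρ : ρ.PosSemidef) (hV : V ∈ swivels σ) (hW : W ∈ swivels S) (z : ℂ) :
    ∃ V' ∈ swivels σ, ∃ W' ∈ swivels S, ‖complexSwiveledOp hR hS U hσ hρ V W z‖ =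
      ‖swiveledOp R S U σ ρ (z.re / 2) ((1 - z.re) / 2) V' W'‖ := by
  refine ⟨_, mul_mem_swivels (spectralMap_phase_mem_swivels hσ ((1 / 2) * z.im)) hV,
    _, mul_mem_swivels hW (spectralMap_phase_mem_swivels hS ((-1 / 2) * z.im)), ?_⟩
  have hfac : complexSwiveledOp hR hS U hσ hρ V W z =
      (spectralMap hR.isHermitian (phase ((1 / 2) * z.im)) ⊗ₖ (1 : Matrix e e ℂ)) *
        (swiveledOp R S U σ ρ (z.re / 2) ((1 - z.re) / 2)
          (spectralMap hσ.isHermitian (phase ((1 / 2) * z.im)) * V)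
          (W * spectralMap hS.isHermitian (phase ((-1 / 2) * z.im))) *
        spectralMap hρ.isHermitian (phase ((-1 / 2) * z.im))) := by
    unfold complexSwiveledOp swiveledOp
    rw [spectralMap_cpowSupp_affine hR, spectralMap_cpowSupp_affine hS,
      spectralMap_cpowSupp_affine hσ, spectralMap_cpowSupp_affine hρ]
    rw [spectralMap_phase_comm hσ, spectralMap_phase_comm hρ]
    simp only [← Matrix.mul_assoc, ← mul_kronecker_mul, Matrix.one_mul]
    rw [show 1 / 2 * z.re + 0 = z.re / 2 by ring, show -1 / 2 * z.re + 0 = -(z.re / 2) by ring,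
      show -1 / 2 * z.re + 1 / 2 = (1 - z.re) / 2 by ring]
  rw [hfac, frobenius_norm_mul_of_isometry
      (kronecker_one_isometry (spectralMap_phase_mem_swivels hR _).1),
    frobenius_norm_mul_unitary (spectralMap_phase_mem_swivels hρ _).1]

lemma opPow_zero_idem {A : Matrix n n ℂ} (hA : A.PosSemidef) :
    opPow A 0 * opPow A 0 = opPow A 0 := by
  rw [opPow_mul hA, add_zero]

lemma frobenius_norm_kronecker_opPow_zero_mul_le {k : Type*} [Fintype k] (hR : R.PosSemidef)
    (X : Matrix (m × e) k ℂ) :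
      ‖(opPow R 0 ⊗ₖ (1 : Matrix e e ℂ)) * X‖ ≤ ‖X‖ := by
  refine frobenius_norm_mul_of_projection ?_ ?_ X
  · rw [conjTranspose_kronecker, conjTranspose_opPow hR.isHermitian, conjTranspose_one]
  · rw [← mul_kronecker_mul, opPow_zero_idem hR, Matrix.one_mul]

lemma frobenius_norm_opPow_half {A : Matrix n n ℂ} (hA : A.PosSemidef) (h1 : A.trace = 1) :
    ‖opPow A (1 / 2)‖ = 1 := by
  rw [← sq_eq_sq₀ (norm_nonneg _) zero_le_one, frobenius_norm_sq,
    conjTranspose_opPow hA.isHermitian, opPow_mul hA, add_halves, opPow_one hA, h1]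
  simp

/-- With s = 0 every factor before ρ^(1/2) is a support projection, a unitary or an isometry, hence
a contraction. -/
lemma norm_swiveledOp_zero_le (hR : R.PosSemidef) (hS : S.PosSemidef) (hσ : σ.PosSemidef)
    (hρ : ρ.PosSemidef) (h1 : ρ.trace = 1) (hU : Uᴴ * U = 1) (hV : V ∈ swivels σ)
    (hW : W ∈ swivels S) : ‖swiveledOp R S U σ ρ 0 (1 / 2) V W‖ ≤ 1 := by
  have hfac : swiveledOp R S U σ ρ 0 (1 / 2) V W =
      (opPow R 0 ⊗ₖ (1 : Matrix e e ℂ)) * ((W ⊗ₖ (1 : Matrix e e ℂ)) *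
        ((opPow S 0 ⊗ₖ (1 : Matrix e e ℂ)) * (U * (opPow σ 0 * (V * opPow ρ (1 / 2)))))) := by
    unfold swiveledOp
    simp only [neg_zero, ← Matrix.mul_assoc, ← mul_kronecker_mul, Matrix.one_mul]
  rw [hfac]
  refine (frobenius_norm_kronecker_opPow_zero_mul_le hR _).trans ?_
  rw [frobenius_norm_mul_of_isometry (kronecker_one_isometry hW.1)]
  refine (frobenius_norm_kronecker_opPow_zero_mul_le hS _).trans ?_
  rw [frobenius_norm_mul_of_isometry hU]
  refine (frobenius_norm_mul_of_projection (conjTranspose_opPow hσ.isHermitian 0)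
    (opPow_zero_idem hσ) _).trans ?_
  rw [frobenius_norm_mul_of_isometry (mem_unitaryGroup_iff'.1 hV.1),
    frobenius_norm_opPow_half hρ h1]

/-- After ρ^0 and V are removed, the partial trace turns Uσ^(1/2) into S^(1/2), which cancels
S^(-1/2) up to a projection and leaves R^(1/2). -/
lemma norm_swiveledOp_half_le (hR : R.PosSemidef) (hR1 : R.trace = 1) (hS : S.PosSemidef)
    (hσ : σ.PosSemidef) (hρ : ρ.PosSemidef) (hSU : partialTraceRight (U * σ * Uᴴ) = S)
    (hV : V ∈ swivels σ) (hW : W ∈ swivels S) :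
    ‖swiveledOp R S U σ ρ (1 / 2) 0 V W‖ ≤ 1 := by
  unfold swiveledOp
  refine (frobenius_norm_mul_projection (conjTranspose_opPow hρ.isHermitian 0)
    (opPow_zero_idem hρ) _).trans ?_
  rw [frobenius_norm_mul_unitary hV.1,
    frobenius_norm_kronecker_mul _ _ _ (partialTraceRight_sqrt hσ hS hSU), Matrix.mul_assoc,
    opPow_mul hS, neg_add_cancel]
  refine (frobenius_norm_mul_projection (conjTranspose_opPow hS.isHermitian 0)
    (opPow_zero_idem hS) _).trans ?_
  rw [frobenius_norm_mul_unitary hW.1, frobenius_norm_opPow_half hR hR1]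

/-- The range of Uσ^(1/2) lies in supp(S) ⊗ H_E: its component along 1 - S^0 has the norm of (1 -
S^0) S^(1/2) = 0. -/
lemma opPow_zero_kronecker_mul_sqrt (hσ : σ.PosSemidef) (hS : S.PosSemidef)
    (hSU : partialTraceRight (U * σ * Uᴴ) = S) :
    (opPow S 0 ⊗ₖ (1 : Matrix e e ℂ)) * (U * opPow σ (1 / 2)) = U * opPow σ (1 / 2) := by
  have h : ‖((1 - opPow S 0) ⊗ₖ (1 : Matrix e e ℂ)) * U * opPow σ (1 / 2)‖ = 0 := by
    rw [frobenius_norm_kronecker_mul _ _ _ (partialTraceRight_sqrt hσ hS hSU), Matrix.sub_mul,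
      opPow_mul hS, zero_add, Matrix.one_mul, sub_self, norm_zero]
  have h2 : ((1 - opPow S 0) ⊗ₖ (1 : Matrix e e ℂ)) =
      1 - opPow S 0 ⊗ₖ (1 : Matrix e e ℂ) := by
    rw [eq_sub_iff_add_eq, ← add_kronecker, sub_add_cancel, one_kronecker_one]
  rw [norm_eq_zero, h2, Matrix.mul_assoc, Matrix.sub_mul, Matrix.one_mul, sub_eq_zero] at h
  exact h.symm

/-- Supplies the interior point of norm 1 for the extrapolation: the support condition makes all
three projections R^0, S^0, σ^0 act trivially. -/
lemma swiveledOp_zero_one_one (hR : R.PosSemidef) (hS : S.PosSemidef) (hσ : σ.PosSemidef)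
    (hρ : ρ.PosSemidef) (hRU : partialTraceRight (U * ρ * Uᴴ) = R)
    (hSU : partialTraceRight (U * σ * Uᴴ) = S) (hsupp : opSupport ρ ≤ opSupport σ) :
    swiveledOp R S U σ ρ 0 (1 / 2) 1 1 = U * opPow ρ (1 / 2) := by
  have hP : opPow σ 0 * opPow ρ (1 / 2) = opPow ρ (1 / 2) := by
    have : opPow ρ (1 / 2) = ρ * opPow ρ (-1 / 2) := by
      nth_rewrite 2 [← opPow_one hρ]
      rw [opPow_mul hρ]
      norm_num
    rw [this, ← Matrix.mul_assoc, opPow_zero_mul_of_opSupport_le hρ.isHermitian hσ hsupp]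
  have hQ : (opPow S 0 ⊗ₖ (1 : Matrix e e ℂ)) * (U * opPow ρ (1 / 2)) = U * opPow ρ (1 / 2) := by
    -- Since σ^0 fixes ρ^(1/2), a factor Uσ^(1/2) can be split off, and S^0 ⊗ I fixes it.
    have : U * opPow ρ (1 / 2) = U * opPow σ (1 / 2) * (opPow σ (-1 / 2) * opPow ρ (1 / 2)) := by
      rw [Matrix.mul_assoc, ← Matrix.mul_assoc (opPow σ _), opPow_mul hσ]
      norm_num [hP]
    rw [this, ← Matrix.mul_assoc, opPow_zero_kronecker_mul_sqrt hσ hS hSU]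
  unfold swiveledOp
  rw [neg_zero, Matrix.mul_one, Matrix.mul_one, Matrix.mul_assoc, hP, Matrix.mul_assoc,
    show (opPow R 0 * opPow S 0) ⊗ₖ (1 : Matrix e e ℂ) =
      (opPow R 0 ⊗ₖ (1 : Matrix e e ℂ)) * (opPow S 0 ⊗ₖ (1 : Matrix e e ℂ)) by
      rw [← mul_kronecker_mul, Matrix.one_mul], Matrix.mul_assoc, hQ,
    opPow_zero_kronecker_mul_sqrt hρ hR hRU]

/-- Interpolation between the orders `1` and `0`. -/
lemma norm_swiveledOp_le_one (hR : R.PosSemidef) (hR1 : R.trace = 1) (hS : S.PosSemidef)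
    (hσ : σ.PosSemidef) (hρ : ρ.PosSemidef) (hρ1 : ρ.trace = 1) (hU : Uᴴ * U = 1)
    (hSU : partialTraceRight (U * σ * Uᴴ) = S) (hV : V ∈ swivels σ) (hW : W ∈ swivels S)
    {θ : ℝ} (h0 : 0 ≤ θ) (h1 : θ ≤ 1) :
    ‖swiveledOp R S U σ ρ (θ / 2) ((1 - θ) / 2) V W‖ ≤ 1 := by
  have h := (matrixStripBounded_complexSwiveledOp (U := U) (V := V) (W := W) hR hS hσ
    hρ).three_lines zero_lt_one (a := 1) (b := 1) (z := (θ : ℂ)) ?_ ?_ h0 h1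
  · rwa [complexSwiveledOp_ofReal, Real.one_rpow, Real.one_rpow, one_mul] at h
  · intro z hz
    obtain ⟨V', hV', W', hW', h⟩ := norm_complexSwiveledOp (U := U) hR hS hσ hρ hV hW z
    rw [h, hz]
    simpa using norm_swiveledOp_zero_le hR hS hσ hρ hρ1 hU hV' hW'
  · intro z hz
    obtain ⟨V', hV', W', hW', h⟩ := norm_complexSwiveledOp (U := U) hR hS hσ hρ hV hW z
    rw [h, hz]
    simpa using norm_swiveledOp_half_le hR hR1 hS hσ hρ hSU hV' hW'

/-- Extrapolation beyond order `1`: some swiveled operator has norm at least `1`. -/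
lemma one_le_of_norm_swiveledOp_le (hR : R.PosSemidef) (hR1 : R.trace = 1) (hS : S.PosSemidef)
    (hσ : σ.PosSemidef) (hρ : ρ.PosSemidef) (hρ1 : ρ.trace = 1) (hU : Uᴴ * U = 1)
    (hRU : partialTraceRight (U * ρ * Uᴴ) = R) (hSU : partialTraceRight (U * σ * Uᴴ) = S)
    (hsupp : opSupport ρ ≤ opSupport σ) {τ c : ℝ} (hτ : 0 < τ)
    (hc : ∀ V ∈ swivels σ, ∀ W ∈ swivels S,
      ‖swiveledOp R S U σ ρ (-τ / 2) ((1 + τ) / 2) V W‖ ≤ c) : 1 ≤ c := by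
  have hc0 : 0 ≤ c := (norm_nonneg _).trans (hc 1 (one_mem_swivels σ) 1 (one_mem_swivels S))
  -- The family starts from V = W = 1; nontrivial swivels appear only through the phases on the
  -- boundary lines.
  have h := (matrixStripBounded_complexSwiveledOp (U := U) (V := 1) (W := 1) hR hS hσ
    hρ).three_lines (l := -τ) (u := 1) (a := c) (b := 1) (z := ((0 : ℝ) : ℂ)) (by linarith)
    ?_ ?_ (by simpa using hτ.le) (by simp)
  · rw [complexSwiveledOp_ofReal, zero_div, sub_zero,
      swiveledOp_zero_one_one hR hS hσ hρ hRU hSU hsupp, frobenius_norm_mul_of_isometry hU,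
      frobenius_norm_opPow_half hρ hρ1, Real.one_rpow, mul_one] at h
    by_contra hlt
    -- The exponent of c is 1 - τ/(1+τ) = 1/(1+τ), so c < 1 would force the norm 1 at z = 0 to be
    -- below 1.
    have hexp : 0 < 1 - ((((0 : ℝ) : ℂ)).re - -τ) / (1 - -τ) := by
      rw [Complex.ofReal_re, sub_pos, div_lt_one (by linarith)]
      linarith
    exact absurd h (not_le.2 (Real.rpow_lt_one hc0 (not_le.1 hlt) hexp))
  · intro z hz
    obtain ⟨V', hV', W', hW', h⟩ := norm_complexSwiveledOp (U := U) hR hS hσ hρ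
      (one_mem_swivels σ) (one_mem_swivels S) z
    rw [h, hz, sub_neg_eq_add]
    exact hc V' hV' W' hW'
  · intro z hz
    obtain ⟨V', hV', W', hW', h⟩ := norm_complexSwiveledOp (U := U) hR hS hσ hρ
      (one_mem_swivels σ) (one_mem_swivels S) z
    rw [h, hz]
    simpa using norm_swiveledOp_half_le hR hR1 hS hσ hρ hSU hV' hW'

end SwiveledOperator

/-! ### Hölder's inequality against powers of a density operator -/

section Holder

open scoped Matrix.Norms.Frobenius

lemma spectralMap_const {n : Type*} [Fintype n] [DecidableEq n] {A : Matrix n n ℂ}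
    (hA : A.IsHermitian) (c : ℂ) : spectralMap hA (fun _ => c) = c • (1 : Matrix n n ℂ) := by
  rw [spectralMap, ← smul_one_eq_diagonal, Matrix.mul_smul, Matrix.mul_one, Matrix.smul_mul,
    eigenvectorUnitary_mul_conjTranspose]

lemma spectralMap_const_mul {n : Type*} [Fintype n] [DecidableEq n] {A : Matrix n n ℂ}
    (hA : A.IsHermitian) (c : ℂ) (f : ℝ → ℂ) :
    spectralMap hA (fun x => c * f x) = c • spectralMap hA f := by
  rw [← spectralMap_mul hA (fun _ => c) f, spectralMap_const, Matrix.smul_mul, Matrix.one_mul]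

/-- Weighted AM-GM for x y^(-(1-a)/a) and y with weights a and 1 - a: the powers of y cancel. The
factor `rpowSupp 0 y` is needed because at y = 0 the right side vanishes. -/
lemma rpowSupp_mul_rpowSupp_le {a x y : ℝ} (ha0 : 0 < a) (ha1 : a < 1) (hx : 0 ≤ x)
    (hy : 0 ≤ y) :
    rpowSupp a x * rpowSupp 0 y ≤ a * x * rpowSupp (-((1 - a) / a)) y + (1 - a) * y := by
  unfold rpowSupp
  rcases eq_or_ne y 0 with rfl | hy0
  · simp
  have hy' : 0 < y := lt_of_le_of_ne hy (Ne.symm hy0)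
  simp only [hy0, if_false, Real.rpow_zero, mul_one]
  rcases eq_or_ne x 0 with rfl | hx0
  · simp only [if_true, mul_zero, zero_mul, zero_add]
    exact mul_nonneg (by linarith) hy
  simp only [hx0, if_false]
  have h := Real.geom_mean_le_arith_mean2_weighted ha0.le (sub_nonneg.2 ha1.le)
    (mul_nonneg hx (Real.rpow_nonneg hy (-((1 - a) / a)))) hy (by ring)
  rw [Real.mul_rpow hx (Real.rpow_nonneg hy _), ← Real.rpow_mul hy, mul_assoc,
    ← Real.rpow_add hy', show -((1 - a) / a) * a + (1 - a) = 0 by field_simp; ring,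
    Real.rpow_zero, mul_one] at h
  linarith

/-- Young's inequality for x/b and y^((a-1)/a), multiplied by b; the free scale b is later set to
the squared norm bound. The factor 1 matches the product form of `trace_spectralMap_mul_le`. -/
lemma mul_rpowSupp_le {a b x y : ℝ} (ha : 1 < a) (hb : 0 < b) (hx : 0 ≤ x) (hy : 0 ≤ y) :
    x * rpowSupp ((a - 1) / a) y ≤
      b / a / b ^ a * rpowSupp a x * 1 + b * ((a - 1) / a) * y := by
  have ha0 : 0 < a := by linarith
  have hτ : 0 < (a - 1) / a := div_pos (by linarith) ha0
  have hrp : ∀ {s z : ℝ}, s ≠ 0 → rpowSupp s z = z ^ s := by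
    intro s z hs
    unfold rpowSupp
    split_ifs with h
    · rw [h, Real.zero_rpow hs]
    · rfl
  rw [hrp hτ.ne', hrp ha0.ne']
  have hxb : 0 ≤ x / b := div_nonneg hx hb.le
  have h := Real.geom_mean_le_arith_mean2_weighted (one_div_pos.2 ha0).le hτ.le
    (Real.rpow_nonneg hxb a) hy (by field_simp; ring)
  rw [← Real.rpow_mul hxb, mul_one_div_cancel ha0.ne', Real.rpow_one,
    Real.div_rpow hx hb.le] at h
  have h2 := mul_le_mul_of_nonneg_left h hb.le
  calc x * y ^ ((a - 1) / a) = b * (x / b * y ^ ((a - 1) / a)) := by field_simp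
    _ ≤ _ := h2
    _ = _ := by ring

variable {k n : Type*} [Fintype k] [Fintype n] [DecidableEq n] {ρ : Matrix n n ℂ}

lemma frobenius_norm_sq_mul_opPow (hρ : ρ.PosSemidef) (X : Matrix k n ℂ) (s : ℝ) :
    ‖X * opPow ρ s‖ ^ 2 = (Xᴴ * X * opPow ρ (2 * s)).trace.re := by
  rw [frobenius_norm_sq, conjTranspose_mul, conjTranspose_opPow hρ.isHermitian, Matrix.mul_assoc,
    trace_mul_comm, two_mul, ← opPow_mul hρ]
  simp only [Matrix.mul_assoc]

/-- Hölder's inequality for exponents below `1`. -/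
lemma trace_opPow_le_one (hρ : ρ.PosSemidef) (hρ1 : ρ.trace = 1) {X : Matrix k n ℂ}
    (hX : X * opPow ρ 0 = X) {a : ℝ} (ha0 : 0 < a) (ha1 : a < 1)
    (h : ‖X * opPow ρ (-((1 - a) / a) / 2)‖ ≤ 1) : (opPow (Xᴴ * X) a).trace.re ≤ 1 := by
  have hM := posSemidef_conjTranspose_mul_self X
  have hK := trace_spectralMap_mul_le hM.isHermitian hρ.isHermitian
    (f₃ := rpowSupp a) (g₃ := rpowSupp 0) (f₁ := fun x => a * x)
    (g₁ := rpowSupp (-((1 - a) / a))) (f₂ := fun _ => 1 - a) (g₂ := fun y => y)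
    fun i j => rpowSupp_mul_rpowSupp_le ha0 ha1 (hM.eigenvalues_nonneg i) (hρ.eigenvalues_nonneg j)
  -- The factor ρ^0 introduced by the scalar inequality is absorbed, because X†X stands on the right
  -- of (X†X)^(a-1).
  have hL : opPow (Xᴴ * X) a * opPow ρ 0 = opPow (Xᴴ * X) a := by
    have : opPow (Xᴴ * X) a = opPow (Xᴴ * X) (a - 1) * (Xᴴ * X) := by
      nth_rewrite 3 [← opPow_one hM]
      rw [opPow_mul hM, sub_add_cancel]
    rw [this, Matrix.mul_assoc, Matrix.mul_assoc, hX]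
  have hsq : (Xᴴ * X * opPow ρ (-((1 - a) / a))).trace.re ≤ 1 := by
    have := frobenius_norm_sq_mul_opPow hρ X (-((1 - a) / a) / 2)
    rw [mul_div_cancel₀ _ two_ne_zero] at this
    rw [← this]
    exact pow_le_one₀ (norm_nonneg _) h
  push_cast at hK
  rw [← opPow_eq, ← opPow_eq, ← opPow_eq, hL, spectralMap_const_mul, spectralMap_ofReal,
    spectralMap_ofReal, spectralMap_const, Matrix.smul_mul, Matrix.smul_mul, Matrix.one_mul,
    trace_smul, trace_smul, hρ1, smul_eq_mul, smul_eq_mul, Complex.re_ofReal_mul, mul_one] at hK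
  have h1 : ((1 : ℂ) - (a : ℂ)).re = 1 - a := by simp
  rw [h1] at hK
  nlinarith

/-- Hölder's inequality for exponents above `1`. -/
lemma frobenius_norm_mul_opPow_le (hρ : ρ.PosSemidef) (hρ1 : ρ.trace = 1) {X : Matrix k n ℂ}
    {a c : ℝ} (ha : 1 < a) (hc : 0 < c) (h : (opPow (Xᴴ * X) a).trace.re ≤ (c ^ 2) ^ a) :
    ‖X * opPow ρ ((a - 1) / a / 2)‖ ≤ c := by
  have hM := posSemidef_conjTranspose_mul_self X
  have ha0 : 0 < a := by linarith
  have hc2 : 0 < c ^ 2 := by positivity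
  -- With scale c², the trace hypothesis bounds the first term by c²/a, and Tr ρ = 1 makes the
  -- second c²(a-1)/a; they add up to c².
  have hK := trace_spectralMap_mul_le hM.isHermitian hρ.isHermitian
    (f₃ := fun x => x) (g₃ := rpowSupp ((a - 1) / a))
    (f₁ := fun x => c ^ 2 / a / (c ^ 2) ^ a * rpowSupp a x)
    (g₁ := fun _ => 1) (f₂ := fun _ => c ^ 2 * ((a - 1) / a)) (g₂ := fun y => y)
    fun i j => mul_rpowSupp_le ha hc2 (hM.eigenvalues_nonneg i) (hρ.eigenvalues_nonneg j)
  have hsq := frobenius_norm_sq_mul_opPow hρ X ((a - 1) / a / 2)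
  rw [mul_div_cancel₀ _ two_ne_zero] at hsq
  simp only [Complex.ofReal_mul (c ^ 2 / a / (c ^ 2) ^ a), Complex.ofReal_one] at hK
  rw [← opPow_eq, spectralMap_const_mul, ← opPow_eq, spectralMap_ofReal,
    spectralMap_ofReal, spectralMap_const, spectralMap_const, one_smul, Matrix.mul_one,
    Matrix.smul_mul, Matrix.one_mul, trace_smul, trace_smul, hρ1, smul_eq_mul, smul_eq_mul,
    Complex.re_ofReal_mul, Complex.re_ofReal_mul, ← hsq, Complex.one_re, mul_one] at hK
  have hpos : 0 < (c ^ 2) ^ a := Real.rpow_pos_of_pos hc2 a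
  have h1 : c ^ 2 / a / (c ^ 2) ^ a * (opPow (Xᴴ * X) a).trace.re ≤ c ^ 2 / a :=
    calc _ ≤ c ^ 2 / a / (c ^ 2) ^ a * (c ^ 2) ^ a := by gcongr
      _ = _ := div_mul_cancel₀ _ hpos.ne'
  have h2 : c ^ 2 / a + c ^ 2 * ((a - 1) / a) = c ^ 2 := by field_simp; ring
  exact le_of_sq_le_sq (by linarith) hc.le

lemma frobenius_norm_sq_eq_sum_col {l : Type*} [Fintype l] (B : Matrix k l ℂ) :
    ‖B‖ ^ 2 = ∑ j, ‖WithLp.toLp 2 (B.col j)‖ ^ 2 := by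
  rw [frobenius_norm_def, ← Real.sqrt_eq_rpow, Real.sq_sqrt (by positivity), Finset.sum_comm]
  simp [EuclideanSpace.norm_sq_eq]

/-- Columnwise operator-norm bound; it plays the role of Hölder's inequality at α = ∞. -/
lemma frobenius_norm_mul_le_opNorm_mul {l : Type*} [Fintype l] (X : Matrix k n ℂ)
    (A : Matrix n l ℂ) :
    ‖X * A‖ ≤ ‖(Matrix.toEuclideanLin X).toContinuousLinearMap‖ * ‖A‖ := by
  refine le_of_sq_le_sq ?_ (by positivity)
  rw [mul_pow, frobenius_norm_sq_eq_sum_col, frobenius_norm_sq_eq_sum_col, Finset.mul_sum]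
  refine Finset.sum_le_sum fun j _ => ?_
  rw [← mul_pow]
  gcongr
  exact (Matrix.toEuclideanLin X).toContinuousLinearMap.le_opNorm (WithLp.toLp 2 (A.col j))

end Holder

/-! ### From norm bounds to extended-real logarithms -/

section Extended

lemma ereal_mul_iSup_log_nonneg_of_le_one {α β : Type*} {s : Set α} {t : Set β} {f : α → β → ℝ}
    {r : ℝ} (hr : r ≤ 0) (hf : ∀ a ∈ s, ∀ b ∈ t, f a b ≤ 1) :
    0 ≤ (r : EReal) * ⨆ a ∈ s, ⨆ b ∈ t, ENNReal.log (ENNReal.ofReal (f a b)) := by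
  have h : ⨆ a ∈ s, ⨆ b ∈ t, ENNReal.log (ENNReal.ofReal (f a b)) ≤ 0 :=
    iSup₂_le fun a ha => iSup₂_le fun b hb => by
      rw [ENNReal.log_le_zero_iff]
      exact ENNReal.ofReal_le_one.2 (hf a ha b hb)
  have h2 := EReal.mul_le_mul_of_nonpos_right (EReal.coe_nonpos.2 hr) h
  rwa [zero_mul] at h2

/-- The hypothesis speaks of upper bounds, so attainment of the supremum is not needed: if the
supremum of the logarithms were negative, exp u for a real u between it and 0 would be an upper
bound below 1. -/
lemma ereal_mul_iSup_log_nonneg_of_one_le {α β : Type*} {s : Set α} {t : Set β} {f : α → β → ℝ}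
    {r : ℝ} (hr : 0 ≤ r)
    (hf : ∀ c : ℝ, 0 < c → (∀ a ∈ s, ∀ b ∈ t, f a b ≤ c) → 1 ≤ c) :
    0 ≤ (r : EReal) * ⨆ a ∈ s, ⨆ b ∈ t, ENNReal.log (ENNReal.ofReal (f a b)) := by
  refine mul_nonneg (by exact_mod_cast hr) ?_
  by_contra! hlt
  obtain ⟨u, hu1, hu2⟩ := EReal.lt_iff_exists_real_btwn.1 hlt
  have hu0 : u < 0 := by exact_mod_cast hu2
  refine absurd (hf (Real.exp u) (Real.exp_pos u) fun a ha b hb => ?_)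
    (not_le.2 (Real.exp_lt_one_iff.2 hu0))
  have h1 : ENNReal.log (ENNReal.ofReal (f a b)) ≤
      ENNReal.log (ENNReal.ofReal (Real.exp u)) := by
    rw [ENNReal.log_ofReal_of_pos (Real.exp_pos u), Real.log_exp]
    refine le_trans ?_ hu1.le
    exact (le_iSup₂ (f := fun b _ => ENNReal.log (ENNReal.ofReal (f a b))) b hb).trans
      (le_iSup₂ (f := fun a _ => ⨆ b ∈ t, ENNReal.log (ENNReal.ofReal (f a b))) a ha)
  rw [ENNReal.log_le_log_iff] at h1
  exact (ENNReal.ofReal_le_ofReal_iff (Real.exp_pos u).le).1 h1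

end Extended

/-! ### Reduction of both Rényi quantities to the interpolating family -/

section Main

open scoped Matrix.Norms.Frobenius

variable {n m e : Type*} [Fintype n] [DecidableEq n] [Fintype m] [DecidableEq m]
    [Fintype e] [DecidableEq e]

lemma swiveledOp_mul_opPow {R S : Matrix m m ℂ} {U : Matrix (m × e) n ℂ} {σ ρ : Matrix n n ℂ}
    (hρ : ρ.PosSemidef) (s c d : ℝ) (V : Matrix n n ℂ) (W : Matrix m m ℂ) :
    swiveledOp R S U σ ρ s c V W * opPow ρ d = swiveledOp R S U σ ρ s (c + d) V W := by
  unfold swiveledOp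
  rw [Matrix.mul_assoc, opPow_mul hρ]

lemma swiveledDelta_eq (α : ℝ) (ρ σ : Matrix n n ℂ) (N : QuantumChannel n m)
    (U : Matrix (m × e) n ℂ) :
    swiveledDelta α ρ σ N U = ((2 / (α - 1) : ℝ) : EReal) *
      ⨆ V ∈ swivels σ, ⨆ W ∈ swivels (N.map σ), ENNReal.log (ENNReal.ofReal
        ‖swiveledOp (N.map ρ) (N.map σ) U σ ρ ((1 - α) / 2) (α / 2) V W‖) := by
  simp only [swiveledDelta, swiveledOp, schattenNorm_two,
    show -((1 - α) / 2) = (α - 1) / 2 by ring]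

lemma swiveledDeltaTilde_eq (α : ℝ≥0∞) (ρ σ : Matrix n n ℂ) (N : QuantumChannel n m)
    (U : Matrix (m × e) n ℂ) :
    swiveledDeltaTilde α ρ σ N U = ((2 / renyiPrime α : ℝ) : EReal) *
      ⨆ V ∈ swivels σ, ⨆ W ∈ swivels (N.map σ), ENNReal.log (ENNReal.ofReal
        (schattenNorm (2 * α)
          (swiveledOp (N.map ρ) (N.map σ) U σ ρ (-renyiPrime α / 2) (1 / 2) V W))) := by
  simp only [swiveledDeltaTilde, swiveledOp,
    show -(-renyiPrime α / 2) = renyiPrime α / 2 by ring]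

/-- If the Schatten norm of order `2α`, `1 < α`, of `X` is at most `c`, then so is the Frobenius
norm of `X ρ ^ (α' / 2)`. -/
lemma frobenius_norm_mul_opPow_le_of_schattenNorm_le {k : Type*} [Fintype k] {ρ : Matrix n n ℂ}
    (hρ : ρ.PosSemidef) (hρ1 : ρ.trace = 1) {X : Matrix k n ℂ} {α : ℝ≥0∞} (hα : 1 < α) {c : ℝ}
    (hc : 0 < c) (h : schattenNorm (2 * α) X ≤ c) :
    ‖X * opPow ρ (renyiPrime α / 2)‖ ≤ c := by
  unfold renyiPrime
  split_ifs with htop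
  · subst htop
    rw [schattenNorm, if_pos (by simp)] at h
    refine (frobenius_norm_mul_le_opNorm_mul _ _).trans ?_
    rwa [frobenius_norm_opPow_half hρ hρ1, mul_one]
  · have ha : 1 < α.toReal := by
      rwa [← ENNReal.toReal_one, ENNReal.toReal_lt_toReal (by simp) htop]
    have ha0 : 0 < α.toReal := by linarith
    refine frobenius_norm_mul_opPow_le hρ hρ1 ha hc ?_
    rw [schattenNorm_two_mul _ htop] at h
    have hM := posSemidef_conjTranspose_mul_self X
    have htr : 0 ≤ (opPow (Xᴴ * X) α.toReal).trace.re :=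
      (Complex.le_def.1 (posSemidef_opPow hM _).trace_nonneg).1
    have h2 := Real.rpow_le_rpow (Real.rpow_nonneg htr _) h (show 0 ≤ 2 * α.toReal by positivity)
    rwa [← Real.rpow_mul htr, one_div_mul_cancel (by positivity), Real.rpow_one,
      Real.rpow_mul hc.le, Real.rpow_two] at h2

end Main

end SwiveledRenyi

open SwiveledRenyi in
theorem mainTheorem9 {n m e : Type*} [Fintype n] [DecidableEq n] [Fintype m] [DecidableEq m]
    [Fintype e] [DecidableEq e] (ρ σ : Matrix n n ℂ) (N : QuantumChannel n m)
    (U : Matrix (m × e) n ℂ) (hρ : IsDensityOperator ρ) (hσ : σ.PosSemidef) (hσ0 : σ ≠ 0)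
    (hU : IsIsometricExtension N U) :
    (∀ α : ℝ, 0 ≤ α → α < 1 → 0 ≤ swiveledDelta α ρ σ N U) ∧
    (∀ α : ℝ, 1 < α → α ≤ 2 → opSupport ρ ≤ opSupport σ → 0 ≤ swiveledDelta α ρ σ N U) ∧
    (∀ α : ℝ≥0∞, 1 / 2 ≤ α → α < 1 → 0 ≤ swiveledDeltaTilde α ρ σ N U) ∧
    (∀ α : ℝ≥0∞, 1 < α → opSupport ρ ≤ opSupport σ → 0 ≤ swiveledDeltaTilde α ρ σ N U) := by
  obtain ⟨hρ, hρ1⟩ := hρ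
  obtain ⟨hUU, hN⟩ := hU
  have hpos : ∀ A : Matrix n n ℂ, A.PosSemidef → (N.map A).PosSemidef := fun A hA => by
    rw [hN]
    exact partialTraceRight_posSemidef (hA.mul_mul_conjTranspose_same U)
  have hR := hpos ρ hρ
  have hS := hpos σ hσ
  have hR1 : (N.map ρ).trace = 1 := (N.trace_map ρ).trans hρ1
  refine ⟨fun α h0 h1 => ?_, fun α h1 _ hsupp => ?_, fun α h0 h1 => ?_, fun α h1 hsupp => ?_⟩
  · rw [swiveledDelta_eq]
    refine ereal_mul_iSup_log_nonneg_of_le_one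
      (div_nonpos_of_nonneg_of_nonpos zero_le_two (by linarith)) fun V hV W hW => ?_
    have h := norm_swiveledOp_le_one hR hR1 hS hσ hρ hρ1 hUU (hN σ).symm hV hW
      (θ := 1 - α) (by linarith) (by linarith)
    rwa [sub_sub_cancel] at h
  · rw [swiveledDelta_eq]
    refine ereal_mul_iSup_log_nonneg_of_one_le
      (div_nonneg zero_le_two (by linarith)) fun c _ hf => ?_
    refine one_le_of_norm_swiveledOp_le hR hR1 hS hσ hρ hρ1 hUU (hN ρ).symm (hN σ).symm hsupp
      (τ := α - 1) (by linarith) fun V hV W hW => ?_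
    rw [neg_sub, add_sub_cancel]
    exact hf V hV W hW
  · have htop : α ≠ ∞ := (h1.trans ENNReal.one_lt_top).ne
    have ha1 : α.toReal < 1 := by
      rwa [← ENNReal.toReal_one, ENNReal.toReal_lt_toReal htop (by simp)]
    have ha2 : 1 / 2 ≤ α.toReal := by
      have := ENNReal.toReal_mono htop h0
      simpa using this
    have ha0 : 0 < α.toReal := by linarith
    have hr : renyiPrime α = -((1 - α.toReal) / α.toReal) := by
      rw [renyiPrime, if_neg htop, ← neg_div, neg_sub]
    have hθ0 : 0 ≤ (1 - α.toReal) / α.toReal := div_nonneg (by linarith) ha0.le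
    -- The condition α ≥ 1/2 says precisely that θ = -α' stays inside the strip [0, 1].
    have hθ1 : (1 - α.toReal) / α.toReal ≤ 1 := by
      rw [div_le_one ha0]
      linarith
    rw [swiveledDeltaTilde_eq]
    refine ereal_mul_iSup_log_nonneg_of_le_one
      (div_nonpos_of_nonneg_of_nonpos zero_le_two (by linarith)) fun V hV W hW => ?_
    rw [schattenNorm_two_mul _ htop]
    refine Real.rpow_le_one
      (Complex.le_def.1 (posSemidef_opPow (Matrix.posSemidef_conjTranspose_mul_self _)
        _).trace_nonneg).1 ?_ (by positivity)
    refine trace_opPow_le_one hρ hρ1 ?_ ha0 ha1 ?_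
    · rw [swiveledOp_mul_opPow hρ, add_zero]
    · have h := norm_swiveledOp_le_one hR hR1 hS hσ hρ hρ1 hUU (hN σ).symm hV hW hθ0 hθ1
      rw [swiveledOp_mul_opPow hρ, hr, neg_neg]
      convert h using 3
      ring
  · have hr : 0 < renyiPrime α := by
      unfold renyiPrime
      split_ifs with htop
      · exact one_pos
      · have ha : 1 < α.toReal := by
          rwa [← ENNReal.toReal_one, ENNReal.toReal_lt_toReal (by simp) htop]
        exact div_pos (by linarith) (by linarith)
    rw [swiveledDeltaTilde_eq]
    refine ereal_mul_iSup_log_nonneg_of_one_le (div_nonneg zero_le_two hr.le) fun c hc hf => ?_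
    refine one_le_of_norm_swiveledOp_le hR hR1 hS hσ hρ hρ1 hUU (hN ρ).symm (hN σ).symm hsupp
      hr fun V hV W hW => ?_
    -- Multiplying by ρ^(α'/2) raises the exponent 1/2 of ρ to (1+α')/2, as the extrapolation with τ
    -- = α' requires.
    have h := frobenius_norm_mul_opPow_le_of_schattenNorm_le hρ hρ1 h1 hc (hf V hV W hW)
    rwa [swiveledOp_mul_opPow hρ, ← add_div] at h
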